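/- Let $p\in(0,1/2)$ and $R\in(0,1)$. For a hash function $h$ on $\mathbb{F}_2^n$ let $$P^h(p)=\Pr\big(h(\mathbf x)=h(\mathbf x+\mathbf e)\big)$$ be its collision probability, where $\mathbf x$ is uniform on $\mathbb{F}_2^n$ and $\mathbf e$ is an independent error vector whose bits are independently nonzero with probability $p$. The error exponent belonging to a collision probability $P$ at length $n$ is $-\frac1n\log_2 P$. A code $\mathcal C\subseteq\mathbb{F}_2^n$ defines a hash $h^{\mathcal C}$ by minimum-weight decoding: each vector is mapped to a codeword at minimum Hamming distance, ties being broken in an arbitrary manner. A code of rate $R$ has $2^k$ codewords with $k=Rn$, where $k$ may be rounded either way if $Rn$ is not an integer, that is, $|k-Rn|<1$. Then there is an $N$, depending only on $p$ and $R$, such that for all $n\ge N$, all such $k$, and every tie-breaking rule, the expectation $P^{\mathcal R}(p)$ of $P^{h^{\mathcal R}}(p)$ over a random code $\mathcal R$ of length $n$ with $2^k$ codewords is strictly greater than the collision probability of projection onto any $k$ of the $n$ coordinates; equivalently, the error exponent $-\frac1n\log_2 P^{\mathcal R}(p)$ is strictly smaller than the error exponent of $k$-projection. This holds both when $\mathcal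 R$ is a uniformly random set of $2^k$ distinct vectors and when $\mathcal R$ is given by $2^k$ independent uniformly random codewords (repetitions allowed). -/

import Mathlib

open scoped BigOperators

namespace CodeHash

/-- The space of binary vectors of length `n`. -/
abbrev Vec (n : ℕ) : Type := Fin n → ZMod 2

/-- The probability of the error vector `e`, when each bit of the error is nonzero with
probability `p`, independently of the others. -/
noncomputable def errorProb {n : ℕ} (p : ℝ) (e : Vec n) : ℝ :=
  ∏ i, if e i = 0 then 1 - p else p

/-- The collision probability of the hash function `h`: the probability that `h x = h (x + e)`,
where `x` is uniform on all vectors and the error vector `e` is independent of `x`. -/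
noncomputable def collisionProb {n : ℕ} {α : Type*} [DecidableEq α] (p : ℝ) (h : Vec n → α) : ℝ :=
  Finset.expect Finset.univ fun x : Vec n =>
    ∑ e : Vec n, if h x = h (x + e) then errorProb p e else 0

/-- The error exponent belonging to a collision probability `P` at block length `n`. -/
noncomputable def errorExponent (n : ℕ) (P : ℝ) : ℝ :=
  -(1 / (n : ℝ)) * Real.logb 2 P

/-- The hash given by projection onto the coordinates in `S`. -/
def projection {n : ℕ} (S : Finset (Fin n)) (x : Vec n) : S → ZMod 2 :=
  fun i => x i

/-- `h` is a minimum-weight decoder for the code `C`: it maps every vector to a codeword at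
the smallest Hamming distance, ties being broken arbitrarily. -/
def IsMinWeightDecoder {n : ℕ} (C : Set (Vec n)) (h : Vec n → Vec n) : Prop :=
  ∀ v, h v ∈ C ∧ ∀ c ∈ C, hammingDist v (h v) ≤ hammingDist v c

/-- The expected collision probability of the hash `h C`, where `C` is a uniformly random set of
`2 ^ k` distinct codewords. -/
noncomputable def expectedCollisionSet {n : ℕ} (k : ℕ) (p : ℝ)
    (h : Finset (Vec n) → Vec n → Vec n) : ℝ :=
  Finset.expect (Finset.powersetCard (2 ^ k) Finset.univ) fun C => collisionProb p (h C)

/-- The expected collision probability of the hash `h f`, where the codebook `f` lists `2 ^ k`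
codewords that are chosen independently and uniformly (repetitions are allowed). -/
noncomputable def expectedCollisionIndep {n : ℕ} (k : ℕ) (p : ℝ)
    (h : (Fin (2 ^ k) → Vec n) → Vec n → Vec n) : ℝ :=
  Finset.expect Finset.univ fun f : Fin (2 ^ k) → Vec n => collisionProb p (h f)

end CodeHash

/-!
A minimum-weight decoder certainly maps `x` and `x + e` to the same codeword `c` when `c` lies
within a radius `w` of both and no other codeword lies within `w` of either. Choose `w` just below
the typical distance to the code, so that `2 ^ k` balls of radius `w` fill at most a quarter of the
space. Then, for both random models, a union bound shows that the second condition costs at most a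
factor `2` (`half_mul_expect_le_of_moments`), and the expected collision probability is at least
`2 ^ k / 2` times the probability that a uniform vector `u` and its noisy copy `u + e` both lie in
the ball of radius `w` around `0` (`expect_collisionProb_ge`). Tie-breaking plays no role, as the
nearest codeword is unique in the cases that are counted.

Projection has collision probability `(1 - p) ^ k`, so the theorem says that Hamming balls are
exponentially more noise stable than subcubes of about the same size. The stability of the ball is
bounded from below by a change of measure (`eventually_le_ballStability`): tilting the law of a pair
of noisy bits by `t ^ (a + b)` with `t < 1` makes pairs of weight about `w` typical, and a Chernoff
bound does the rest. Comparing exponents, with `r = p / (1 - p)` and `2 ^ c = 2 (1 + r)`, everything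
reduces to the two-point inequality
`(1 + t ^ (2 / c)) ^ c < 1 + 2 r t + t ^ 2` for `0 < t < 1` (`two_point_inequality`). It is applied
with the parameter `s = t ^ (2 / c)` in the bound `(1 + s) ^ n / s ^ w` for the size of the ball.
The strictness of the inequality leaves exponential room, which absorbs all constant factors and
the rounding of `R n` to `k`.
-/

namespace CodeHash

/-! ### The two-point inequality and the tilting parameter -/

section TwoPoint

open Real Set

/-- The difference of the two logarithms is governed by an auxiliary function `Ψ`: with
`G x = log (1 + 2rx + x²) - c log (1 + x ^ (2 / c))`, which vanishes at `0` and at `1`, the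
derivative of `G` has the sign of `Ψ`, and `Ψ` is strictly convex in `log x` with `Ψ 1 = 0`. So `G`
cannot first decrease and later increase, which `G t ≤ 0` would force. The relation between `c` and
`r` says exactly that `G 1 = 0`. -/
theorem two_point_inequality {r c t : ℝ} (hr0 : 0 < r) (hr1 : r < 1) (hc0 : 0 < c)
    (hc : c * log 2 = log (2 * (1 + r))) (ht0 : 0 < t) (ht1 : t < 1) :
    c * log (1 + t ^ (2 / c)) < log (1 + 2 * r * t + t ^ 2) := by
  by_contra! hcon
  set G : ℝ → ℝ := fun x => log (1 + 2 * r * x + x ^ 2) - c * log (1 + x ^ (2 / c)) with hG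
  set Ψ : ℝ → ℝ := fun x => (1 - 2 / c) * log x + log (r + x) - log (1 + r * x) with hΨ
  have hq : 0 < 2 / c := by positivity
  have hGcont : ContinuousOn G (Icc 0 1) := by
    intro x hx
    have hx0 := hx.1
    have h1 : (1 + 2 * r * x + x ^ 2) ≠ 0 := by positivity
    have h2 : (1 + x ^ (2 / c)) ≠ 0 := by positivity
    have h3 : ContinuousAt (fun y : ℝ => y ^ (2 / c)) x :=
      continuousAt_rpow_const _ _ (Or.inr hq.le)
    apply ContinuousAt.continuousWithinAt
    fun_prop (disch := assumption)
  have hGderiv : ∀ x ∈ Ioo (0 : ℝ) 1, HasDerivAt G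
      ((2 * r + 2 * x) / (1 + 2 * r * x + x ^ 2) -
        c * ((2 / c) * x ^ (2 / c - 1) / (1 + x ^ (2 / c)))) x := by
    intro x hx
    have hx0 := hx.1
    have h1 : (1 + 2 * r * x + x ^ 2) ≠ 0 := by positivity
    have h2 : (1 + x ^ (2 / c)) ≠ 0 := by positivity
    have d1 : HasDerivAt (fun y : ℝ => 1 + 2 * r * y + y ^ 2) (2 * r + 2 * x) x := by
      simpa using (((hasDerivAt_id x).const_mul (2 * r)).const_add 1).fun_add (hasDerivAt_pow 2 x)
    have d2 : HasDerivAt (fun y : ℝ => 1 + y ^ (2 / c)) ((2 / c) * x ^ (2 / c - 1)) x :=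
      (Real.hasDerivAt_rpow_const (Or.inl hx0.ne')).const_add 1
    exact (d1.log h1).sub ((d2.log h2).const_mul c)
  have hG0 : G 0 = 0 := by simp [hG, zero_rpow hq.ne']
  have hG1 : G 1 = 0 := by
    simp only [hG, one_rpow]
    norm_num
    rw [hc, sub_eq_zero]; congr 1; ring
  have hGt : G t ≤ 0 := by simpa [hG] using hcon
  -- the sign of the derivative of `G` is the sign of `Ψ`
  have hsign : ∀ x ∈ Ioo (0 : ℝ) 1, x * ((2 * r + 2 * x) / (1 + 2 * r * x + x ^ 2) -
        c * ((2 / c) * x ^ (2 / c - 1) / (1 + x ^ (2 / c)))) =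
      2 * (x * (r + x) - x ^ (2 / c) * (1 + r * x)) /
        ((1 + 2 * r * x + x ^ 2) * (1 + x ^ (2 / c))) := by
    intro x hx
    have hx0 := hx.1
    have h1 : (1 + 2 * r * x + x ^ 2) ≠ 0 := by positivity
    have h2 : (1 + x ^ (2 / c)) ≠ 0 := by positivity
    have h3 : x ^ (2 / c) = x ^ (2 / c - 1) * x := by
      rw [rpow_sub_one hx0.ne']; field_simp
    rw [h3] at h2 ⊢
    field_simp
    ring
  have hΨlog : ∀ x ∈ Ioo (0 : ℝ) 1,
      Ψ x = log (x * (r + x)) - log (x ^ (2 / c) * (1 + r * x)) := by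
    intro x hx
    have hx0 := hx.1
    rw [log_mul (by positivity) (by positivity), log_mul (by positivity) (by positivity),
      log_rpow hx0]
    simp only [hΨ]; ring
  obtain ⟨a, ha, ha'⟩ := exists_hasDerivAt_eq_slope G _ ht0
    (hGcont.mono (Icc_subset_Icc le_rfl ht1.le))
    (fun x hx => hGderiv x ⟨hx.1, hx.2.trans ht1⟩)
  obtain ⟨b, hb, hb'⟩ := exists_hasDerivAt_eq_slope G _ ht1
    (hGcont.mono (Icc_subset_Icc ht0.le le_rfl))
    (fun x hx => hGderiv x ⟨ht0.trans hx.1, hx.2⟩)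
  have ha01 : a ∈ Ioo (0 : ℝ) 1 := ⟨ha.1, ha.2.trans ht1⟩
  have hb01 : b ∈ Ioo (0 : ℝ) 1 := ⟨ht0.trans hb.1, hb.2⟩
  have hΨa : Ψ a ≤ 0 := by
    have h := hsign a ha01
    have hpos := ha01.1
    rw [ha', hG0] at h
    have h2 : a * ((G t - 0) / (t - 0)) ≤ 0 :=
      mul_nonpos_of_nonneg_of_nonpos hpos.le
        (div_nonpos_of_nonpos_of_nonneg (by linarith) (by linarith))
    rw [h] at h2
    rw [hΨlog a ha01, sub_nonpos]
    apply log_le_log (by positivity)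
    by_contra! h3
    have : 0 < 2 * (a * (r + a) - a ^ (2 / c) * (1 + r * a)) /
        ((1 + 2 * r * a + a ^ 2) * (1 + a ^ (2 / c))) :=
      div_pos (by linarith) (by positivity)
    linarith
  have hΨb : 0 ≤ Ψ b := by
    have h := hsign b hb01
    have hpos := hb01.1
    rw [hb', hG1] at h
    have h2 : 0 ≤ b * ((0 - G t) / (1 - t)) :=
      mul_nonneg hpos.le (div_nonneg (by linarith) (by linarith))
    rw [h] at h2
    rw [hΨlog b hb01, sub_nonneg]
    apply log_le_log (by positivity)
    by_contra! h3
    have : 2 * (b * (r + b) - b ^ (2 / c) * (1 + r * b)) /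
        ((1 + 2 * r * b + b ^ 2) * (1 + b ^ (2 / c))) < 0 :=
      div_neg_of_neg_of_pos (by linarith) (by positivity)
    linarith
  have hΨ1 : Ψ 1 = 0 := by simp [hΨ, add_comm]
  have hΨderiv : ∀ x : ℝ, 0 < x → HasDerivAt Ψ
      ((1 - 2 / c) * x⁻¹ + 1 / (r + x) - r / (1 + r * x)) x := by
    intro x hx
    have d1 : HasDerivAt (fun y : ℝ => r + y) 1 x := (hasDerivAt_id x).const_add r
    have d2 : HasDerivAt (fun y : ℝ => 1 + r * y) r x := by
      simpa using ((hasDerivAt_id x).const_mul r).const_add 1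
    exact (((hasDerivAt_log hx.ne').const_mul _).add (d1.log (by positivity))).sub
      (d2.log (by positivity))
  have hab : a < b := ha.2.trans hb.1
  have hΨcont : ∀ x y : ℝ, 0 < x → ContinuousOn Ψ (Icc x y) := fun x y hx z hz =>
    (hΨderiv z (hx.trans_le hz.1)).continuousAt.continuousWithinAt
  obtain ⟨y, hy, hy'⟩ := exists_hasDerivAt_eq_slope Ψ _ hab (hΨcont a b ha01.1)
    (fun x hx => hΨderiv x (ha01.1.trans hx.1))
  obtain ⟨z, hz, hz'⟩ := exists_hasDerivAt_eq_slope Ψ _ hb01.2 (hΨcont b 1 hb01.1)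
    (fun x hx => hΨderiv x (hb01.1.trans hx.1))
  have hy0 : 0 < y := ha01.1.trans hy.1
  have hz0 : 0 < z := hb01.1.trans hz.1
  have hyz : y < z := hy.2.trans hz.1
  -- `x * Ψ' x`, the derivative of `Ψ` in the variable `log x`, is strictly increasing on `(0, 1)`
  have hform : ∀ x : ℝ, 0 < x → x * ((1 - 2 / c) * x⁻¹ + 1 / (r + x) - r / (1 + r * x)) =
      (1 - 2 / c) + (1 - r ^ 2) * (x / ((r + x) * (1 + r * x))) := by
    intro x hx
    have h1 : r + x ≠ 0 := by positivity
    have h2 : 1 + r * x ≠ 0 := by positivity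
    field_simp
    ring
  have e1 : 0 ≤ (1 - 2 / c) + (1 - r ^ 2) * (y / ((r + y) * (1 + r * y))) := by
    rw [← hform y hy0, hy']
    exact mul_nonneg hy0.le (div_nonneg (by linarith) (by linarith))
  have e2 : (1 - 2 / c) + (1 - r ^ 2) * (z / ((r + z) * (1 + r * z))) ≤ 0 := by
    rw [← hform z hz0, hz', hΨ1]
    exact mul_nonpos_of_nonneg_of_nonpos hz0.le
      (div_nonpos_of_nonpos_of_nonneg (by linarith) (by linarith [hb01.2]))
  have e3 : y / ((r + y) * (1 + r * y)) < z / ((r + z) * (1 + r * z)) := by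
    rw [div_lt_div_iff₀ (by positivity) (by positivity)]
    have h1 : y * z < 1 := mul_lt_one_of_nonneg_of_lt_one_left hy0.le (hyz.trans hz.2) hz.2.le
    have h2 : 0 < r * (z - y) * (1 - y * z) :=
      mul_pos (mul_pos hr0 (sub_pos.2 hyz)) (sub_pos.2 h1)
    have h3 : z * ((r + y) * (1 + r * y)) - y * ((r + z) * (1 + r * z)) =
      r * (z - y) * (1 - y * z) := by ring
    linarith
  have e4 : 0 < 1 - r ^ 2 := sub_pos.2 (pow_lt_one₀ hr0.le hr1 two_ne_zero)
  have e5 := mul_lt_mul_of_pos_left e3 e4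
  linarith

/-- The tilting parameter `t` is found by the intermediate value theorem for the mean of the two
outer expressions, which runs from `0` at `t = 0` to `c log 2` at `t = 1`; the two-point inequality
separates them. The left expression is `c` times the exponential growth rate of a Hamming ball of
relative radius `(rt + t²) / (1 + 2rt + t²)`, the right one is the growth rate of the weighted
number of pairs inside the ball. -/
theorem exists_tilting_parameter {r c R : ℝ} (hr0 : 0 < r) (hr1 : r < 1) (hc0 : 0 < c)
    (hc : c * log 2 = log (2 * (1 + r))) (hR0 : 0 < R) (hR1 : R < 1) :
    ∃ t : ℝ, 0 < t ∧ t < 1 ∧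
      c * log (1 + t ^ (2 / c)) - 2 * ((r * t + t ^ 2) / (1 + 2 * r * t + t ^ 2)) * log t <
        (1 - R) * (c * log 2) ∧
      (1 - R) * (c * log 2) <
        log (1 + 2 * r * t + t ^ 2) -
          2 * ((r * t + t ^ 2) / (1 + 2 * r * t + t ^ 2)) * log t := by
  have hq : 0 < 2 / c := by positivity
  -- written with `t * log t`, which is continuous at `0`
  set F : ℝ → ℝ := fun t => (c * log (1 + t ^ (2 / c)) + log (1 + 2 * r * t + t ^ 2)) / 2 -
    2 * ((r + t) / (1 + 2 * r * t + t ^ 2)) * (t * log t) with hF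
  have hFcont : ContinuousOn F (Icc 0 1) := by
    intro x hx
    have hx0 := hx.1
    have h1 : (1 + 2 * r * x + x ^ 2) ≠ 0 := by positivity
    have h2 : (1 + x ^ (2 / c)) ≠ 0 := by positivity
    have h3 : ContinuousAt (fun y : ℝ => y ^ (2 / c)) x :=
      continuousAt_rpow_const _ _ (Or.inr hq.le)
    have h4 : ContinuousAt (fun y : ℝ => y * log y) x := continuous_mul_log.continuousAt
    apply ContinuousAt.continuousWithinAt
    fun_prop (disch := assumption)
  have hF0 : F 0 = 0 := by simp [hF, zero_rpow hq.ne']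
  have hF1 : F 1 = c * log 2 := by
    simp only [hF, one_rpow, log_one]
    have : (1 + 2 * r * 1 + 1 ^ 2 : ℝ) = 2 * (1 + r) := by ring
    rw [this, ← hc]; norm_num
  have hcl : 0 < c * log 2 := mul_pos hc0 (log_pos (by norm_num))
  obtain ⟨t, ht, hFt⟩ := intermediate_value_Icc zero_le_one hFcont
    (show (1 - R) * (c * log 2) ∈ Icc (F 0) (F 1) by
      rw [hF0, hF1]; constructor <;> nlinarith)
  have ht0 : 0 < t := by
    rcases ht.1.lt_or_eq with h | h
    · exact h
    · rw [← h, hF0] at hFt; nlinarith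
  have ht1 : t < 1 := by
    rcases ht.2.lt_or_eq with h | h
    · exact h
    · rw [h, hF1] at hFt; nlinarith
  have key := two_point_inequality hr0 hr1 hc0 hc ht0 ht1
  have e : 2 * ((r + t) / (1 + 2 * r * t + t ^ 2)) * (t * log t) =
      2 * ((r * t + t ^ 2) / (1 + 2 * r * t + t ^ 2)) * log t := by ring
  simp only [hF, e] at hFt
  exact ⟨t, ht0, ht1, by linarith, by linarith⟩

end TwoPoint

/-! ### Size and noise stability of Hamming balls -/

section Ball

open Real Finset

/-- Chernoff bound: for independent samples from the distribution `q`, the sum of a bounded function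
`g` of negative mean is nonnegative with exponentially small probability. -/
theorem exists_product_tail_bound {α : Type*} [Fintype α] (q g : α → ℝ) (hq0 : ∀ a, 0 ≤ q a)
    (hq1 : ∑ a, q a = 1) (hg : ∀ a, |g a| ≤ 1) (hneg : ∑ a, q a * g a < 0) :
    ∃ l : ℝ, 0 ≤ l ∧ l < 1 ∧ ∀ n : ℕ,
      ∑ z : Fin n → α, (if 0 ≤ ∑ i, g (z i) then ∏ i, q (z i) else 0) ≤ l ^ n := by
  classical
  set m := ∑ a, q a * g a with hm
  have hm1 : -1 ≤ m := by
    rw [hm, ← hq1, ← sum_neg_distrib]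
    exact sum_le_sum fun a _ => by nlinarith [hq0 a, abs_le.1 (hg a)]
  -- `l` is the moment generating function of `g` at `-m / 2`, the minimizer of `1 + θ m + θ²`
  refine ⟨∑ a, q a * exp (-m / 2 * g a),
    sum_nonneg fun a _ => mul_nonneg (hq0 a) (exp_pos _).le, ?_, fun n => ?_⟩
  · have hθ : |m| ≤ 1 := abs_le.2 ⟨hm1, by linarith⟩
    have hle : ∀ a, q a * exp (-m / 2 * g a) ≤
        q a + -m / 2 * (q a * g a) + (m / 2) ^ 2 * q a := by
      intro a
      have h1 : |(-m / 2 * g a)| ≤ 1 := by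
        rw [abs_mul, abs_div, abs_neg, abs_two]
        nlinarith [abs_nonneg m, abs_nonneg (g a), hg a]
      have h2 := (abs_le.1 (abs_exp_sub_one_sub_id_le h1)).2
      have h3 : (g a) ^ 2 ≤ 1 := (sq_le_one_iff_abs_le_one _).2 (hg a)
      have h4 : (-m / 2 * g a) ^ 2 ≤ (m / 2) ^ 2 := by
        nlinarith [mul_le_mul_of_nonneg_left h3 (sq_nonneg (m / 2))]
      have := mul_le_mul_of_nonneg_left (show exp (-m / 2 * g a) ≤
        1 + -m / 2 * g a + (m / 2) ^ 2 by linarith) (hq0 a)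
      linarith
    calc _ ≤ ∑ a, (q a + -m / 2 * (q a * g a) + (m / 2) ^ 2 * q a) := sum_le_sum fun a _ => hle a
      _ = 1 - m ^ 2 / 4 := by
        rw [sum_add_distrib, sum_add_distrib, ← mul_sum, ← mul_sum, hq1, ← hm]; ring
      _ < 1 := by nlinarith
  · calc _ ≤ ∑ z : Fin n → α, ∏ i, (q (z i) * exp (-m / 2 * g (z i))) := by
          refine sum_le_sum fun z _ => ?_
          have h0 : 0 ≤ ∏ i, q (z i) := prod_nonneg fun i _ => hq0 _
          rw [prod_mul_distrib, ← exp_sum, ← mul_sum]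
          split_ifs with h
          · exact le_mul_of_one_le_right h0 (one_le_exp (mul_nonneg (by linarith) h))
          · positivity
      _ = _ := (Fintype.sum_pow (fun a => q a * exp (-m / 2 * g a)) n).symm

theorem sum_zmod_two {M : Type*} [AddCommMonoid M] (f : ZMod 2 → M) : ∑ a, f a = f 0 + f 1 :=
  Fin.sum_univ_two f

theorem prod_ite_eq_pow_hammingNorm {n : ℕ} (s : ℝ) (u : Vec n) :
    ∏ i, (if u i = 0 then 1 else s) = s ^ hammingNorm u := by
  rw [prod_ite]; simp [hammingNorm]

theorem sum_pow_hammingNorm (n : ℕ) (s : ℝ) :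
    ∑ u : Vec n, s ^ hammingNorm u = (1 + s) ^ n := by
  simp_rw [← prod_ite_eq_pow_hammingNorm]
  rw [← Fintype.sum_pow (fun a : ZMod 2 => if a = 0 then 1 else s), sum_zmod_two]
  simp

/-- The number of vectors in a Hamming ball of real radius `w` in `Vec n`. -/
noncomputable def ballCard (n : ℕ) (w : ℝ) : ℕ := #{u : Vec n | (hammingNorm u : ℝ) ≤ w}

/-- Each vector `u` of the ball contributes at least `1` to `∑ u, s ^ (|u| - w)`. -/
theorem ballCard_le (n : ℕ) {s w : ℝ} (hs0 : 0 < s) (hs1 : s ≤ 1) :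
    (ballCard n w : ℝ) ≤ (1 + s) ^ n * s ^ (-w) := by
  rw [← sum_pow_hammingNorm, sum_mul, ballCard, card_eq_sum_ones, Nat.cast_sum, sum_filter]
  refine sum_le_sum fun u _ => ?_
  split_ifs with h
  · rw [← rpow_natCast, ← rpow_add hs0, Nat.cast_one]
    exact one_le_rpow_of_pos_of_le_one_of_nonpos hs0 hs1 (by linarith)
  · positivity

/-- The number of pairs `(u, u + e)` inside the Hamming ball of radius `w` around `0`, each weighted
with the probability of the error `e`; divided by `2 ^ n`, it is the noise stability of the ball. -/
noncomputable def ballStability (n : ℕ) (p w : ℝ) : ℝ :=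
  ∑ u : Vec n, ∑ e : Vec n,
    if (hammingNorm u : ℝ) ≤ w ∧ (hammingNorm (u + e) : ℝ) ≤ w then errorProb p e else 0

/-- The pair `(u, u + e)` as a single word over the alphabet `ZMod 2 × ZMod 2`, on which the weight
is a product. -/
theorem ballStability_eq (n : ℕ) (p w : ℝ) :
    ballStability n p w = ∑ z : Fin n → ZMod 2 × ZMod 2,
      if (hammingNorm (fun i => (z i).1) : ℝ) ≤ w ∧ (hammingNorm (fun i => (z i).2) : ℝ) ≤ w then
        ∏ i, (if (z i).1 = (z i).2 then 1 - p else p) else 0 := by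
  rw [← (Equiv.arrowProdEquivProdArrow (Fin n) (fun _ => ZMod 2) (fun _ => ZMod 2)).symm.sum_comp,
    Fintype.sum_prod_type, ballStability]
  refine sum_congr rfl fun u _ => ?_
  rw [← (Equiv.addLeft u).symm.sum_comp]
  refine sum_congr rfl fun v _ => ?_
  simp [Equiv.arrowProdEquivProdArrow, errorProb, CharTwo.add_eq_zero]
  rfl

theorem sum_bit_eq_hammingNorm {n : ℕ} (u : Vec n) :
    ∑ i, (if u i = 0 then (0 : ℝ) else 1) = hammingNorm u := by
  rw [sum_ite]; simp [hammingNorm]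

/-- Tilting the weight of each pair of bits `(a, b)` by `t ^ (a + b)` and normalizing gives a
probability distribution for which both bits have mean `d`. Under its product, all but half of the
mass lies on pairs whose two weights are within `ε n` of `d n`, and there the tilting factor is
known up to `ε`. -/
theorem eventually_le_ballStability {p t d ε : ℝ} (hp0 : 0 < p) (hp1 : p < 1) (ht0 : 0 < t)
    (ht1 : t < 1) (hε : 0 < ε) (hd0 : ε < d) (hd1 : d + ε < 1)
    (hd : d * ((1 - p) * (1 + t ^ 2) + 2 * p * t) = p * t + (1 - p) * t ^ 2) :
    ∀ᶠ n : ℕ in Filter.atTop, 1 / 2 * (((1 - p) * (1 + t ^ 2) + 2 * p * t) ^ n *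
      t ^ (-(2 * (d - ε) * n))) ≤ ballStability n p ((d + ε) * n) := by
  set Z := (1 - p) * (1 + t ^ 2) + 2 * p * t with hZ
  have hp1' : 0 < 1 - p := by linarith
  have hZ0 : 0 < Z := by positivity
  let K : ZMod 2 × ZMod 2 → ℝ := fun a => if a.1 = a.2 then 1 - p else p
  let W : ZMod 2 → ℝ := fun a => if a = 0 then 1 else t
  let b : ZMod 2 → ℝ := fun a => if a = 0 then 0 else 1
  let q : ZMod 2 × ZMod 2 → ℝ := fun a => K a * (W a.1 * W a.2) / Z
  have hK : ∀ a, 0 < K a := fun a => by simp only [K]; split_ifs <;> assumption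
  have hW : ∀ a, 0 < W a := fun a => by simp only [W]; split_ifs <;> simp [ht0]
  have hb : ∀ a, 0 ≤ b a ∧ b a ≤ 1 := fun a => by simp only [b]; split_ifs <;> simp
  have hq0 : ∀ a, 0 ≤ q a := fun a =>
    div_nonneg (mul_nonneg (hK a).le (mul_nonneg (hW _).le (hW _).le)) hZ0.le
  have hsum : ∀ f : ZMod 2 × ZMod 2 → ℝ,
      ∑ a, f a = f (0, 0) + f (0, 1) + (f (1, 0) + f (1, 1)) := fun f => by
    rw [Fintype.sum_prod_type]
    simp [sum_zmod_two]
  have hq1 : ∑ a, q a = 1 := by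
    rw [hsum]; simp [q, K, W]; field_simp; rw [hZ]; ring
  have hm1 : ∑ a, q a * b a.1 = d := by
    rw [hsum]; simp [q, K, W, b]; field_simp; linarith
  have hm2 : ∑ a, q a * b a.2 = d := by
    rw [hsum]; simp [q, K, W, b]; field_simp; linarith
  obtain ⟨l₁, l₁0, l₁1, h₁⟩ := exists_product_tail_bound q (fun a => b a.1 - (d + ε)) hq0 hq1
    (fun a => abs_le.2 ⟨by linarith [hb a.1], by linarith [hb a.1]⟩)
    (by simp_rw [mul_sub]; rw [sum_sub_distrib, ← sum_mul, hq1, hm1]; linarith)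
  obtain ⟨l₂, l₂0, l₂1, h₂⟩ := exists_product_tail_bound q (fun a => b a.2 - (d + ε)) hq0 hq1
    (fun a => abs_le.2 ⟨by linarith [hb a.2], by linarith [hb a.2]⟩)
    (by simp_rw [mul_sub]; rw [sum_sub_distrib, ← sum_mul, hq1, hm2]; linarith)
  obtain ⟨l₃, l₃0, l₃1, h₃⟩ := exists_product_tail_bound q (fun a => (d - ε) - b a.1) hq0 hq1
    (fun a => abs_le.2 ⟨by linarith [hb a.1], by linarith [hb a.1]⟩)
    (by simp_rw [mul_sub]
        rw [sum_sub_distrib, sum_sub_distrib, ← sum_mul, ← sum_mul, hq1, hm1]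
        linarith)
  obtain ⟨l₄, l₄0, l₄1, h₄⟩ := exists_product_tail_bound q (fun a => (d - ε) - b a.2) hq0 hq1
    (fun a => abs_le.2 ⟨by linarith [hb a.2], by linarith [hb a.2]⟩)
    (by simp_rw [mul_sub]
        rw [sum_sub_distrib, sum_sub_distrib, ← sum_mul, ← sum_mul, hq1, hm2]
        linarith)
  have hev : ∀ᶠ n : ℕ in Filter.atTop, l₁ ^ n + l₂ ^ n + l₃ ^ n + l₄ ^ n < 1 / 2 := by
    have := (((tendsto_pow_atTop_nhds_zero_of_lt_one l₁0 l₁1).add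
      (tendsto_pow_atTop_nhds_zero_of_lt_one l₂0 l₂1)).add
      (tendsto_pow_atTop_nhds_zero_of_lt_one l₃0 l₃1)).add
      (tendsto_pow_atTop_nhds_zero_of_lt_one l₄0 l₄1)
    exact this.eventually_lt_const (by norm_num)
  filter_upwards [hev] with n hn
  rw [ballStability_eq]
  -- `A` is the inverse of the density of the tilted distribution at the lowest typical weight
  set A := Z ^ n * t ^ (-(2 * (d - ε) * n)) with hA
  have hA0 : 0 ≤ A := by positivity
  have htot : ∑ z : Fin n → ZMod 2 × ZMod 2, ∏ i, q (z i) = 1 := by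
    rw [← Fintype.sum_pow, hq1, one_pow]
  have hsb : ∀ u : Vec n, ∑ i, b (u i) = hammingNorm u := sum_bit_eq_hammingNorm
  -- off the four tails, a pair lies in the ball and weighs at least `A` times its tilted
  -- probability; on a tail, the left-hand side is not positive
  have key : ∀ z : Fin n → ZMod 2 × ZMod 2, A * (∏ i, q (z i) -
      (if 0 ≤ ∑ i, (b (z i).1 - (d + ε)) then ∏ i, q (z i) else 0) -
      (if 0 ≤ ∑ i, (b (z i).2 - (d + ε)) then ∏ i, q (z i) else 0) -
      (if 0 ≤ ∑ i, ((d - ε) - b (z i).1) then ∏ i, q (z i) else 0) -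
      (if 0 ≤ ∑ i, ((d - ε) - b (z i).2) then ∏ i, q (z i) else 0)) ≤
      if (hammingNorm (fun i => (z i).1) : ℝ) ≤ (d + ε) * n ∧
        (hammingNorm (fun i => (z i).2) : ℝ) ≤ (d + ε) * n then ∏ i, K (z i) else 0 := by
    intro z
    have hP : 0 ≤ ∏ i, q (z i) := prod_nonneg fun i _ => hq0 _
    have hR : 0 ≤ ∏ i, K (z i) := prod_nonneg fun i _ => (hK _).le
    have hI : ∀ c : Prop, [Decidable c] → 0 ≤ if c then ∏ i, q (z i) else 0 := fun c _ => by
      split_ifs <;> simp [hP]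
    have hI' : ∀ c : Prop, [Decidable c] → 0 ≤ if c then ∏ i, K (z i) else 0 := fun c _ => by
      split_ifs <;> simp [hR]
    by_cases c : 0 ≤ ∑ i, (b (z i).1 - (d + ε)) ∨ 0 ≤ ∑ i, (b (z i).2 - (d + ε)) ∨
      0 ≤ ∑ i, ((d - ε) - b (z i).1) ∨ 0 ≤ ∑ i, ((d - ε) - b (z i).2)
    · refine le_trans (mul_nonpos_of_nonneg_of_nonpos hA0 ?_) (hI' _)
      have i₁ := hI (0 ≤ ∑ i, (b (z i).1 - (d + ε)))
      have i₂ := hI (0 ≤ ∑ i, (b (z i).2 - (d + ε)))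
      have i₃ := hI (0 ≤ ∑ i, ((d - ε) - b (z i).1))
      have i₄ := hI (0 ≤ ∑ i, ((d - ε) - b (z i).2))
      rcases c with c | c | c | c <;> rw [if_pos c] <;> linarith
    · push Not at c
      obtain ⟨c1, c2, c3, c4⟩ := c
      rw [if_neg c1.not_ge, if_neg c2.not_ge, if_neg c3.not_ge, if_neg c4.not_ge]
      rw [sum_sub_distrib] at c1 c2 c3 c4
      rw [hsb (fun i => (z i).1)] at c1 c3
      rw [hsb (fun i => (z i).2)] at c2 c4
      simp only [sum_const, card_univ, Fintype.card_fin, nsmul_eq_mul] at c1 c2 c3 c4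
      rw [if_pos ⟨by linarith, by linarith⟩]
      have hprod : ∏ i, q (z i) = (∏ i, K (z i)) *
          (t ^ hammingNorm (fun i => (z i).1) * t ^ hammingNorm (fun i => (z i).2)) / Z ^ n := by
        simp only [q, prod_div_distrib, prod_mul_distrib, prod_const, card_univ, Fintype.card_fin]
        rw [← prod_ite_eq_pow_hammingNorm, ← prod_ite_eq_pow_hammingNorm]
      have hle : t ^ (-(2 * (d - ε) * n)) *
          (t ^ hammingNorm (fun i => (z i).1) * t ^ hammingNorm (fun i => (z i).2)) ≤ 1 := by
        rw [← pow_add, ← rpow_natCast, ← rpow_add ht0]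
        refine rpow_le_one ht0.le ht1.le ?_
        push_cast
        linarith
      have : A * (∏ i, q (z i) - 0 - 0 - 0 - 0) = (∏ i, K (z i)) * (t ^ (-(2 * (d - ε) * n)) *
          (t ^ hammingNorm (fun i => (z i).1) * t ^ hammingNorm (fun i => (z i).2))) := by
        rw [hprod, hA]
        field_simp
        ring
      rw [this]
      exact mul_le_of_le_one_right hR hle
  refine le_trans ?_ (sum_le_sum fun z _ => key z)
  rw [← mul_sum, sum_sub_distrib, sum_sub_distrib, sum_sub_distrib, sum_sub_distrib, htot]
  nlinarith [h₁ n, h₂ n, h₃ n, h₄ n]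

end Ball

section RandomCode

open Finset

/-! ### Collisions forced by an isolated codeword -/

/-- Write `a i` for the indicator that the codeword `f i` lies within `w` of both `x` and `y`, and
`b j` for the number of the two points within `w` of `f j`. If `f i` lies within `w` of both and no
other codeword within `w` of either, then `x` and `y` are both decoded to `f i`. In all other cases
each term `a i * (1 - ∑ j ≠ i, b j)` is at most `0`. The codebook may list a codeword twice. -/
theorem collision_indicator_ge {n : ℕ} {ι : Type*} [DecidableEq ι] (s : Finset ι)
    (f : ι → Vec n) {h : Vec n → Vec n} (hh : IsMinWeightDecoder (f '' s) h) (w : ℝ)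
    (x y : Vec n) :
    ∑ i ∈ s,
        (if (hammingDist x (f i) : ℝ) ≤ w ∧ (hammingDist y (f i) : ℝ) ≤ w then (1 : ℝ) else 0) -
      ∑ i ∈ s, ∑ j ∈ s.erase i,
        (if (hammingDist x (f i) : ℝ) ≤ w ∧ (hammingDist y (f i) : ℝ) ≤ w then (1 : ℝ) else 0) *
        ((if (hammingDist x (f j) : ℝ) ≤ w then 1 else 0) +
          (if (hammingDist y (f j) : ℝ) ≤ w then 1 else 0)) ≤
      if h x = h y then 1 else 0 := by
  set a : ι → ℝ := fun i =>
    if (hammingDist x (f i) : ℝ) ≤ w ∧ (hammingDist y (f i) : ℝ) ≤ w then (1 : ℝ) else 0 with ha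
  set b : ι → ℝ := fun j => (if (hammingDist x (f j) : ℝ) ≤ w then 1 else 0) +
    (if (hammingDist y (f j) : ℝ) ≤ w then 1 else 0) with hb
  change ∑ i ∈ s, a i - ∑ i ∈ s, ∑ j ∈ s.erase i, a i * b j ≤ _
  have hb0 : ∀ j, 0 ≤ b j := fun j => by simp only [hb]; split_ifs <;> norm_num
  rw [← sum_sub_distrib]
  simp_rw [← mul_sum, ← mul_one_sub]
  have hterm : ∀ i ∈ s, (a i = 1 → ∃ j ∈ s.erase i, 1 ≤ b j) →
      a i * (1 - ∑ j ∈ s.erase i, b j) ≤ 0 := by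
    intro i _ hi
    by_cases c : (hammingDist x (f i) : ℝ) ≤ w ∧ (hammingDist y (f i) : ℝ) ≤ w
    · have hai : a i = 1 := if_pos c
      obtain ⟨j, hj, hbj⟩ := hi hai
      have := single_le_sum (fun k _ => hb0 k) hj
      rw [hai]; linarith
    · have hai : a i = 0 := if_neg c
      simp [hai]
  by_cases hu : ∃ i ∈ s, a i = 1 ∧ ∀ j ∈ s.erase i, b j < 1
  · obtain ⟨i, his, hai, hi⟩ := hu
    have hc : (hammingDist x (f i) : ℝ) ≤ w ∧ (hammingDist y (f i) : ℝ) ≤ w := by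
      by_contra hc
      rw [show a i = 0 from if_neg hc] at hai
      exact zero_ne_one hai
    -- `f i` is the only codeword near `x` or `y`, so both are decoded to it
    have hdec : ∀ v : Vec n, (hammingDist v (f i) : ℝ) ≤ w →
        (∀ j, (hammingDist v (f j) : ℝ) ≤ w → 1 ≤ b j) → h v = f i := by
      intro v hv hvb
      obtain ⟨j, hj, hjv⟩ := (hh v).1
      have hle : (hammingDist v (f j) : ℝ) ≤ w := by
        rw [hjv]
        exact le_trans (by exact_mod_cast (hh v).2 (f i) ⟨i, his, rfl⟩) hv
      by_contra hne
      have hji : j ≠ i := by rintro rfl; exact hne hjv.symm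
      exact (hi j (mem_erase.2 ⟨hji, hj⟩)).not_ge (hvb j hle)
    have hx := hdec x hc.1 fun j hj => by
      simp only [hb, if_pos hj]; split_ifs <;> norm_num
    have hy := hdec y hc.2 fun j hj => by
      simp only [hb, if_pos hj]; split_ifs <;> norm_num
    rw [if_pos (hx.trans hy.symm), ← add_sum_erase _ _ his, hai]
    have h1 : ∑ j ∈ s.erase i, a j * (1 - ∑ k ∈ s.erase j, b k) ≤ 0 := by
      refine sum_nonpos fun j hj => hterm j (mem_of_mem_erase hj) fun _ => ?_
      refine ⟨i, mem_erase.2 ⟨(ne_of_mem_erase hj).symm, his⟩, ?_⟩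
      simp only [hb, if_pos hc.1, if_pos hc.2]; norm_num
    have h2 : 0 ≤ ∑ j ∈ s.erase i, b j := sum_nonneg fun j _ => hb0 j
    linarith
  · push Not at hu
    refine le_trans (sum_nonpos fun i hi => hterm i hi (hu i hi)) ?_
    split_ifs <;> norm_num

/-! ### First and second moments of random codes -/

theorem expect_powersetCard_sum {α : Type*} [Fintype α] [DecidableEq α] {M : ℕ} (hM : 0 < M)
    (hMN : M ≤ Fintype.card α) (a : α → ℝ) :
    𝔼 C ∈ powersetCard M (univ : Finset α), ∑ c ∈ C, a c = M * 𝔼 c, a c := by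
  have hsum : ∑ C ∈ powersetCard M (univ : Finset α), ∑ c ∈ C, a c =
      ((Fintype.card α - 1).choose (M - 1) : ℝ) * ∑ c, a c := by
    rw [sum_comm' (t' := univ) (s' := fun c => {C ∈ powersetCard M (univ : Finset α) | {c} ⊆ C})
      (by simp), mul_sum]
    refine sum_congr rfl fun c _ => ?_
    rw [sum_const, card_filter_powersetCard_subset _ _ _ (subset_univ _)
      (by simpa using Nat.succ_le_of_lt hM)]
    simp
  rw [expect_eq_sum_div_card, expect_eq_sum_div_card, hsum, card_powersetCard, card_univ]
  obtain ⟨M, rfl⟩ := Nat.exists_eq_add_of_lt hM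
  obtain ⟨N, hN⟩ := Nat.exists_eq_add_of_lt (hM.trans_le hMN)
  rw [hN] at hMN ⊢
  simp only [zero_add, Nat.add_sub_cancel] at *
  have h1 : ((N + 1 : ℕ) : ℝ) * N.choose M = (N + 1).choose (M + 1) * (M + 1 : ℕ) := by
    exact_mod_cast Nat.add_one_mul_choose_eq N M
  have h2 : (0 : ℝ) < (N + 1).choose (M + 1) := by exact_mod_cast Nat.choose_pos hMN
  have h3 : (0 : ℝ) < (N + 1 : ℕ) := by positivity
  field_simp
  linear_combination (∑ c, a c) * h1

/-- Without replacement, the inclusion of two distinct elements is negatively correlated. -/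
theorem expect_powersetCard_sum_pair_le {α : Type*} [Fintype α] [DecidableEq α] {M : ℕ}
    (hM : 0 < M) (hMN : M ≤ Fintype.card α) {a b : α → ℝ} (ha : ∀ c, 0 ≤ a c)
    (hb : ∀ c, 0 ≤ b c) :
    𝔼 C ∈ powersetCard M (univ : Finset α), ∑ c ∈ C, ∑ d ∈ C.erase c, a c * b d ≤
      (M * 𝔼 c, a c) * (M * 𝔼 c, b c) := by
  have ha' : 0 ≤ ∑ c, a c := sum_nonneg fun c _ => ha c
  have hb' : 0 ≤ ∑ c, b c := sum_nonneg fun c _ => hb c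
  rcases (Nat.succ_le_of_lt hM).eq_or_lt with h1 | h1
  · -- a single codeword has no pairs
    rw [expect_eq_zero]
    · exact mul_nonneg (mul_nonneg (by positivity) (expect_nonneg fun c _ => ha c))
        (mul_nonneg (by positivity) (expect_nonneg fun c _ => hb c))
    · intro C hC
      obtain ⟨c, rfl⟩ := card_eq_one.1 ((mem_powersetCard.1 hC).2.trans h1.symm)
      simp
  have hsum : ∑ C ∈ powersetCard M (univ : Finset α), ∑ c ∈ C, ∑ d ∈ C.erase c, a c * b d =
      ((Fintype.card α - 2).choose (M - 2) : ℝ) * ∑ c, ∑ d ∈ univ.erase c, a c * b d := by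
    calc _ = ∑ C ∈ powersetCard M (univ : Finset α), ∑ c, ∑ d ∈ univ.erase c,
          (if {c, d} ⊆ C then a c * b d else 0) := by
          refine sum_congr rfl fun C _ => ?_
          rw [← sum_subset (subset_univ C)]
          · refine sum_congr rfl fun c hc => ?_
            rw [← sum_subset (erase_subset_erase c (subset_univ C))]
            · refine sum_congr rfl fun d hd => ?_
              rw [if_pos]
              simp [insert_subset_iff, hc, mem_of_mem_erase hd]
            · intro d hd hd'
              rw [if_neg]
              simp only [insert_subset_iff, singleton_subset_iff]
              exact fun h => hd' (mem_erase.2 ⟨ne_of_mem_erase hd, h.2⟩)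
          · intro c _ hc
            refine sum_eq_zero fun d _ => if_neg ?_
            simp [insert_subset_iff, hc]
      _ = ∑ c, ∑ d ∈ univ.erase c, ∑ C ∈ powersetCard M (univ : Finset α),
          (if {c, d} ⊆ C then a c * b d else 0) := by
          rw [sum_comm]
          exact sum_congr rfl fun c _ => sum_comm
      _ = _ := by
          rw [mul_sum]
          refine sum_congr rfl fun c _ => ?_
          rw [mul_sum]
          refine sum_congr rfl fun d hd => ?_
          have hcd : ({c, d} : Finset α).card = 2 := card_pair (ne_of_mem_erase hd).symm
          rw [← sum_filter, sum_const, card_filter_powersetCard_subset _ _ _ (subset_univ _)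
            (by rw [hcd]; exact h1), hcd, card_univ, nsmul_eq_mul]
  have hle : ∑ c, ∑ d ∈ univ.erase c, a c * b d ≤ (∑ c, a c) * ∑ d, b d := by
    rw [sum_mul_sum]
    exact sum_le_sum fun c _ => sum_le_sum_of_subset_of_nonneg (erase_subset _ _)
      fun d _ _ => mul_nonneg (ha c) (hb d)
  rw [expect_eq_sum_div_card, expect_eq_sum_div_card, expect_eq_sum_div_card, hsum,
    card_powersetCard, card_univ]
  obtain ⟨M, rfl⟩ := Nat.exists_eq_add_of_le (show 2 ≤ M from h1)
  obtain ⟨N, hN⟩ := Nat.exists_eq_add_of_le (le_trans h1 hMN : 2 ≤ _)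
  rw [hN] at hMN ⊢
  rw [add_comm 2 M, add_comm 2 N] at *
  simp only [Nat.add_sub_cancel]
  have hy : (0 : ℝ) < (N + 2).choose (M + 2) := by exact_mod_cast Nat.choose_pos hMN
  have hxy : ((N : ℝ) + 2) * (N + 1) * N.choose M =
      (N + 2).choose (M + 2) * (M + 2) * (M + 1) := by
    have i₁ : ((N : ℝ) + 1) * N.choose M = (N + 1).choose (M + 1) * (M + 1) := by
      exact_mod_cast Nat.add_one_mul_choose_eq N M
    have i₂ : ((N : ℝ) + 2) * (N + 1).choose (M + 1) = (N + 2).choose (M + 2) * (M + 2) := by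
      exact_mod_cast Nat.add_one_mul_choose_eq (N + 1) (M + 1)
    linear_combination ((N : ℝ) + 2) * i₁ + (M + 1 : ℝ) * i₂
  set x : ℝ := (N.choose M : ℝ)
  set y : ℝ := ((N + 2).choose (M + 2) : ℝ)
  have hMN' : (M : ℝ) ≤ N := by exact_mod_cast (by omega : M ≤ N)
  have hxle : x / y ≤ ((M + 2 : ℝ) / (N + 2)) * ((M + 2 : ℝ) / (N + 2)) := by
    have : x / y = ((M + 2 : ℝ) / (N + 2)) * ((M + 1 : ℝ) / (N + 1)) := by
      field_simp; linear_combination hxy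
    rw [this]
    refine mul_le_mul_of_nonneg_left ?_ (by positivity)
    rw [div_le_div_iff₀ (by positivity) (by positivity)]
    linarith
  push_cast
  calc _ = x / y * ∑ c, ∑ d ∈ univ.erase c, a c * b d := by ring
    _ ≤ (((M + 2 : ℝ) / (N + 2)) * ((M + 2 : ℝ) / (N + 2))) * ((∑ c, a c) * ∑ d, b d) :=
        mul_le_mul hxle hle (sum_nonneg fun c _ => sum_nonneg fun d _ => mul_nonneg (ha c) (hb d))
          (by positivity)
    _ = _ := by ring

theorem expect_pi_apply_mul_apply {ι α : Type*} [Fintype ι] [DecidableEq ι] [Fintype α]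
    [Nonempty α] {i j : ι} (hij : i ≠ j) (a b : α → ℝ) :
    𝔼 f : ι → α, a (f i) * b (f j) = (𝔼 c, a c) * 𝔼 c, b c := by
  have hN : (Fintype.card α : ℝ) ≠ 0 := by simp
  calc _ = ∑ f : ι → α, ∏ k, ((if k = i then a (f k) else 1) * (if k = j then b (f k) else 1) /
        Fintype.card α) := by
        rw [expect_eq_sum_div_card, sum_div]
        refine sum_congr rfl fun f _ => ?_
        rw [prod_div_distrib, prod_mul_distrib]
        simp
    _ = ∏ k, ((if k = i then 𝔼 c, a c else 1) * (if k = j then 𝔼 c, b c else 1)) := by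
        rw [← Fintype.piFinset_univ, ← prod_univ_sum (fun _ => univ) (fun k v =>
          (if k = i then a v else 1) * (if k = j then b v else 1) / (Fintype.card α : ℝ))]
        refine prod_congr rfl fun k _ => ?_
        rw [← sum_div, ← card_univ, ← expect_eq_sum_div_card]
        by_cases hi : k = i
        · have hj : k ≠ j := hi ▸ hij
          simp [hi, hij]
        · by_cases hj : k = j <;> simp [hi, hj, hij.symm]
    _ = _ := by rw [prod_mul_distrib]; simp

theorem expect_pi_apply {ι α : Type*} [Fintype ι] [DecidableEq ι] [Fintype α]
    [Nonempty α] (i : ι) (a : α → ℝ) :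
    𝔼 f : ι → α, a (f i) = 𝔼 c, a c := by
  have hN : (Fintype.card α : ℝ) ≠ 0 := by simp
  calc _ = ∑ f : ι → α, ∏ k, ((if k = i then a (f k) else 1) / Fintype.card α) := by
        rw [expect_eq_sum_div_card, sum_div]
        refine sum_congr rfl fun f _ => ?_
        rw [prod_div_distrib]
        simp
    _ = ∏ k, (if k = i then 𝔼 c, a c else 1) := by
        rw [← Fintype.piFinset_univ, ← prod_univ_sum (fun _ => univ) (fun k v =>
          (if k = i then a v else 1) / (Fintype.card α : ℝ))]
        refine prod_congr rfl fun k _ => ?_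
        rw [← sum_div, ← card_univ, ← expect_eq_sum_div_card]
        by_cases hi : k = i <;> simp [hi]
    _ = _ := by simp

/-! ### Collision probabilities of random codes -/

theorem expect_hammingDist_le {n : ℕ} (x : Vec n) (w : ℝ) :
    𝔼 c : Vec n, (if (hammingDist x c : ℝ) ≤ w then (1 : ℝ) else 0) = ballCard n w / 2 ^ n := by
  rw [expect_eq_sum_div_card, ← (Equiv.subLeft x).sum_comp]
  have h : ∀ c : Vec n, hammingDist x (x - c) = hammingNorm c := fun c => by
    rw [hammingDist_comm, hammingDist_eq_hammingNorm]; congr 1; abel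
  simp [h, ballCard]

/-- A union bound: if `4 * 2 ^ k` balls of radius `w` have total size at most that of the
space, and the codewords of a random code are uniform and pairwise at most as correlated as
independent ones, then a codeword within `w` of both `x` and `y` has at least an even chance of
being the only codeword within `w` of either point. -/
theorem half_mul_expect_le_of_moments {n k : ℕ} {w : ℝ} {ι κ : Type*} [DecidableEq ι]
    (hV : 4 * 2 ^ k * (ballCard n w : ℝ) ≤ 2 ^ n) (Ω : Finset κ) (s : κ → Finset ι)
    (f : κ → ι → Vec n) (H : κ → Vec n → Vec n)
    (hH : ∀ ω ∈ Ω, IsMinWeightDecoder (f ω '' s ω) (H ω))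
    (h₁ : ∀ a : Vec n → ℝ, 𝔼 ω ∈ Ω, ∑ i ∈ s ω, a (f ω i) = 2 ^ k * 𝔼 c, a c)
    (h₂ : ∀ a b : Vec n → ℝ, (∀ c, 0 ≤ a c) → (∀ c, 0 ≤ b c) →
      𝔼 ω ∈ Ω, ∑ i ∈ s ω, ∑ j ∈ (s ω).erase i, a (f ω i) * b (f ω j) ≤
        (2 ^ k * 𝔼 c, a c) * (2 ^ k * 𝔼 c, b c))
    (x y : Vec n) :
    2 ^ k / 2 * 𝔼 c : Vec n, (if (hammingDist x c : ℝ) ≤ w ∧ (hammingDist y c : ℝ) ≤ w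
      then (1 : ℝ) else 0) ≤
    𝔼 ω ∈ Ω, if H ω x = H ω y then (1 : ℝ) else 0 := by
  set a : Vec n → ℝ := fun c =>
    if (hammingDist x c : ℝ) ≤ w ∧ (hammingDist y c : ℝ) ≤ w then (1 : ℝ) else 0 with ha
  set b : Vec n → ℝ := fun c => (if (hammingDist x c : ℝ) ≤ w then 1 else 0) +
    (if (hammingDist y c : ℝ) ≤ w then 1 else 0) with hb
  have ha0 : ∀ c, 0 ≤ a c := fun c => by simp only [ha]; split_ifs <;> norm_num
  have hb0 : ∀ c, 0 ≤ b c := fun c => by simp only [hb]; split_ifs <;> norm_num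
  have hbe : 𝔼 c, b c = 2 * ballCard n w / 2 ^ n := by
    rw [expect_add_distrib, expect_hammingDist_le, expect_hammingDist_le]; ring
  have hbe' : 2 ^ k * 𝔼 c, b c ≤ 1 / 2 := by
    rw [hbe, ← mul_div_assoc, div_le_iff₀ (by positivity)]; linarith
  have hA : 0 ≤ 2 ^ k * 𝔼 c, a c := mul_nonneg (by positivity) (expect_nonneg fun c _ => ha0 c)
  calc 2 ^ k / 2 * 𝔼 c, a c ≤ 2 ^ k * 𝔼 c, a c - (2 ^ k * 𝔼 c, a c) * (2 ^ k * 𝔼 c, b c) := by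
        linarith [mul_le_mul_of_nonneg_left hbe' hA]
    _ ≤ 𝔼 ω ∈ Ω, (∑ i ∈ s ω, a (f ω i) -
        ∑ i ∈ s ω, ∑ j ∈ (s ω).erase i, a (f ω i) * b (f ω j)) := by
        rw [expect_sub_distrib]; linarith [h₁ a, h₂ a b ha0 hb0]
    _ ≤ _ := expect_le_expect fun ω hω => collision_indicator_ge (s ω) (f ω) (hH ω hω) w x y

theorem half_mul_expect_le_expect_powersetCard {n k : ℕ} {w : ℝ} (hkn : k ≤ n)
    (hV : 4 * 2 ^ k * (ballCard n w : ℝ) ≤ 2 ^ n) {h : Finset (Vec n) → Vec n → Vec n}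
    (hh : ∀ C : Finset (Vec n), C.card = 2 ^ k → IsMinWeightDecoder (C : Set (Vec n)) (h C))
    (x y : Vec n) :
    2 ^ k / 2 * 𝔼 c : Vec n, (if (hammingDist x c : ℝ) ≤ w ∧ (hammingDist y c : ℝ) ≤ w
      then (1 : ℝ) else 0) ≤
    𝔼 C ∈ powersetCard (2 ^ k) univ, if h C x = h C y then (1 : ℝ) else 0 := by
  have hcard : 2 ^ k ≤ Fintype.card (Vec n) := by
    simpa using Nat.pow_le_pow_right two_pos hkn
  refine half_mul_expect_le_of_moments hV _ id (fun _ => id) h (fun C hC => ?_) (fun a => ?_)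
    (fun a b ha hb => ?_) x y
  · rw [Set.image_id]
    exact hh C (mem_powersetCard.1 hC).2
  · simpa using expect_powersetCard_sum (Nat.two_pow_pos k) hcard a
  · simpa using expect_powersetCard_sum_pair_le (Nat.two_pow_pos k) hcard ha hb

theorem half_mul_expect_le_expect_pi {n k : ℕ} {w : ℝ}
    (hV : 4 * 2 ^ k * (ballCard n w : ℝ) ≤ 2 ^ n) {h : (Fin (2 ^ k) → Vec n) → Vec n → Vec n}
    (hh : ∀ f : Fin (2 ^ k) → Vec n, IsMinWeightDecoder (Set.range f) (h f)) (x y : Vec n) :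
    2 ^ k / 2 * 𝔼 c : Vec n, (if (hammingDist x c : ℝ) ≤ w ∧ (hammingDist y c : ℝ) ≤ w
      then (1 : ℝ) else 0) ≤
    𝔼 f : Fin (2 ^ k) → Vec n, if h f x = h f y then (1 : ℝ) else 0 := by
  refine half_mul_expect_le_of_moments hV univ (fun _ => univ) id h (fun f _ => ?_) (fun a => ?_)
    (fun a b ha hb => ?_) x y
  · rw [coe_univ, Set.image_univ]
    exact hh f
  · rw [expect_sum_comm]
    simp [expect_pi_apply]
  · have hA0 : 0 ≤ 𝔼 c, a c := expect_nonneg fun c _ => ha c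
    have hB0 : 0 ≤ 𝔼 c, b c := expect_nonneg fun c _ => hb c
    rw [expect_sum_comm]
    calc _ = ∑ i : Fin (2 ^ k), ∑ j ∈ univ.erase i, (𝔼 c, a c) * 𝔼 c, b c := by
          refine sum_congr rfl fun i _ => ?_
          rw [expect_sum_comm]
          exact sum_congr rfl fun j hj => expect_pi_apply_mul_apply (ne_of_mem_erase hj).symm a b
      _ ≤ ∑ i : Fin (2 ^ k), ∑ j : Fin (2 ^ k), (𝔼 c, a c) * 𝔼 c, b c :=
          sum_le_sum fun i _ => sum_le_sum_of_subset_of_nonneg (erase_subset _ _)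
            fun j _ _ => mul_nonneg hA0 hB0
      _ = _ := by simp; ring

theorem errorProb_nonneg {n : ℕ} {p : ℝ} (hp0 : 0 ≤ p) (hp1 : p ≤ 1) (e : Vec n) :
    0 ≤ errorProb p e :=
  prod_nonneg fun i _ => by split_ifs <;> linarith

/-- Averaging over `x`: shifting `x` by the codeword `c` turns the condition that `x` and `x + e`
lie within `w` of `c` into one about the ball around `0`. -/
theorem expect_collisionProb_ge {n : ℕ} {p w m : ℝ} (hp0 : 0 ≤ p) (hp1 : p ≤ 1) {κ : Type*}
    (Ω : Finset κ) (H : κ → Vec n → Vec n)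
    (hH : ∀ x y, m * 𝔼 c : Vec n, (if (hammingDist x c : ℝ) ≤ w ∧ (hammingDist y c : ℝ) ≤ w
      then (1 : ℝ) else 0) ≤ 𝔼 ω ∈ Ω, if H ω x = H ω y then (1 : ℝ) else 0) :
    m / 2 ^ n * ballStability n p w ≤ 𝔼 ω ∈ Ω, collisionProb p (H ω) := by
  have hstab : ∀ c : Vec n, 𝔼 x : Vec n, ∑ e : Vec n, errorProb p e *
      (if (hammingDist x c : ℝ) ≤ w ∧ (hammingDist (x + e) c : ℝ) ≤ w then (1 : ℝ) else 0) =
      ballStability n p w / 2 ^ n := by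
    intro c
    rw [expect_eq_sum_div_card, ← Equiv.sum_comp (Equiv.addRight c)]
    have h1 : ∀ u : Vec n, hammingDist (u + c) c = hammingNorm u := fun u => by
      rw [hammingDist_comm, hammingDist_eq_hammingNorm]; congr 1; abel
    have h2 : ∀ u e : Vec n, hammingDist (u + c + e) c = hammingNorm (u + e) := fun u e => by
      rw [add_right_comm, h1]
    simp [h1, h2, ballStability]
  calc m / 2 ^ n * ballStability n p w
      = m * 𝔼 c : Vec n, 𝔼 x : Vec n, ∑ e : Vec n, errorProb p e *
        (if (hammingDist x c : ℝ) ≤ w ∧ (hammingDist (x + e) c : ℝ) ≤ w then (1 : ℝ) else 0) := by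
        simp_rw [hstab]
        rw [expect_const univ_nonempty]; ring
    _ = 𝔼 x : Vec n, ∑ e : Vec n, errorProb p e * (m * 𝔼 c : Vec n,
        (if (hammingDist x c : ℝ) ≤ w ∧ (hammingDist (x + e) c : ℝ) ≤ w then (1 : ℝ) else 0)) := by
        rw [expect_comm, mul_expect]
        refine expect_congr rfl fun x _ => ?_
        rw [expect_sum_comm, mul_sum]
        refine sum_congr rfl fun e _ => ?_
        rw [← mul_expect]; ring
    _ ≤ 𝔼 x : Vec n, ∑ e : Vec n, errorProb p e *
        𝔼 ω ∈ Ω, (if H ω x = H ω (x + e) then (1 : ℝ) else 0) :=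
        expect_le_expect fun x _ => sum_le_sum fun e _ =>
          mul_le_mul_of_nonneg_left (hH x (x + e)) (errorProb_nonneg hp0 hp1 e)
    _ = _ := by
        simp only [collisionProb]
        rw [expect_comm]
        refine expect_congr rfl fun x _ => ?_
        rw [expect_sum_comm]
        refine sum_congr rfl fun e _ => ?_
        rw [mul_expect]
        simp

/-! ### Collision probability of projections -/

theorem collisionProb_projection {n : ℕ} (p : ℝ) (S : Finset (Fin n)) :
    collisionProb p (projection S) = (1 - p) ^ S.card := by
  have h : ∀ x e : Vec n, projection S x = projection S (x + e) ↔ ∀ i ∈ S, e i = 0 := by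
    intro x e
    simp [funext_iff, projection]
  simp only [collisionProb, h]
  rw [expect_const univ_nonempty]
  calc _ = ∑ e : Vec n, ∏ i, (if e i = 0 then 1 - p else if i ∈ S then 0 else p) := by
        refine sum_congr rfl fun e _ => ?_
        split_ifs with he
        · refine prod_congr rfl fun i _ => ?_
          split_ifs with h1 h2
          · rfl
          · exact absurd (he i h2) h1
          · rfl
        · push Not at he
          obtain ⟨i, hi, hei⟩ := he
          exact (prod_eq_zero (mem_univ i) (by simp [hi, hei])).symm
    _ = ∏ i, ∑ a : ZMod 2, (if a = 0 then 1 - p else if i ∈ S then 0 else p) := by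
        rw [← Fintype.piFinset_univ, ← prod_univ_sum (fun _ => univ) (fun i (a : ZMod 2) =>
          if a = 0 then 1 - p else if i ∈ S then 0 else p)]
    _ = ∏ i, (if i ∈ S then 1 - p else 1) := by
        refine prod_congr rfl fun i _ => ?_
        rw [sum_zmod_two]
        by_cases hi : i ∈ S <;> simp [hi]
    _ = _ := by simp [prod_ite_mem]

end RandomCode

/-! ### Comparison of exponents -/

section Exponent

open Real

/-- For large `n`, the radius `w = (d + ε) n` makes the balls small enough for the union bound and
their noise stability large enough to beat projection. With `r = p / (1 - p)` and
`2 (1 + r) = 2 / (1 - p)`, both conditions, after taking logarithms, hold with slacks `η₁ n` and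
`η₂ n`, up to bounded errors coming from the constants and from rounding `R n` to `k`. -/
theorem eventually_exists_radius {p R : ℝ} (hp0 : 0 < p) (hp : p < 1 / 2) (hR0 : 0 < R)
    (hR : R < 1) :
    ∀ᶠ n : ℕ in Filter.atTop, ∀ k : ℕ, |(k : ℝ) - R * n| < 1 →
      ∃ w : ℝ, 4 * 2 ^ k * (ballCard n w : ℝ) ≤ 2 ^ n ∧
        (1 - p) ^ k < 2 ^ k / 2 / 2 ^ n * ballStability n p w := by
  have hp1 : 0 < 1 - p := by linarith
  have hl2 : 0 < log 2 := log_pos one_lt_two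
  set r := p / (1 - p) with hr
  have hr0 : 0 < r := div_pos hp0 hp1
  have hr1 : r < 1 := (div_lt_one hp1).2 (by linarith)
  set Λ := log (2 * (1 + r)) with hΛ
  have hΛ0 : 0 < Λ := log_pos (by linarith)
  have hΛp : Λ = log 2 - log (1 - p) := by
    rw [hΛ, ← log_div two_ne_zero hp1.ne', hr]
    congr 1; field_simp; ring
  set c := Λ / log 2 with hcdef
  have hc0 : 0 < c := div_pos hΛ0 hl2
  have hc : c * log 2 = Λ := div_mul_cancel₀ _ hl2.ne'
  obtain ⟨t, ht0, ht1, hJ, hL⟩ := exists_tilting_parameter hr0 hr1 hc0 hc hR0 hR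
  set d := (r * t + t ^ 2) / (1 + 2 * r * t + t ^ 2) with hd
  have hden : 0 < 1 + 2 * r * t + t ^ 2 := by positivity
  have hd0 : 0 < d := by positivity
  have hd1 : d < 1 := (div_lt_one hden).2 (by nlinarith [mul_pos hr0 ht0])
  obtain ⟨ε, hε0, hεd, hεd1, hJ', hL'⟩ : ∃ ε : ℝ, 0 < ε ∧ ε < d ∧ d + ε < 1 ∧
      c * log (1 + t ^ (2 / c)) - 2 * (d + ε) * log t < (1 - R) * (c * log 2) ∧
      (1 - R) * (c * log 2) < log (1 + 2 * r * t + t ^ 2) - 2 * (d - ε) * log t := by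
    have e1 : ∀ᶠ ε in nhds (0 : ℝ), ε < d := eventually_lt_nhds hd0
    have e2 : ∀ᶠ ε in nhds (0 : ℝ), d + ε < 1 :=
      (Continuous.tendsto' (by fun_prop) 0 d (by simp)).eventually_lt_const hd1
    have e3 := (Continuous.tendsto' (f := fun ε : ℝ => c * log (1 + t ^ (2 / c)) -
      2 * (d + ε) * log t) (by fun_prop) 0 _ (by simp only [add_zero])).eventually_lt_const hJ
    have e4 := (Continuous.tendsto' (f := fun ε : ℝ => log (1 + 2 * r * t + t ^ 2) -
      2 * (d - ε) * log t) (by fun_prop) 0 _ (by simp only [sub_zero])).eventually_const_lt hL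
    have e : ∀ᶠ ε in nhdsWithin (0 : ℝ) (Set.Ioi 0), 0 < ε := eventually_mem_nhdsWithin
    obtain ⟨ε, h0, ⟨⟨h1, h2⟩, h3⟩, h4⟩ :=
      (e.and ((((e1.and e2).and e3).and e4).filter_mono nhdsWithin_le_nhds)).exists
    exact ⟨ε, h0, h1, h2, h3, h4⟩
  set s := t ^ (2 / c) with hs
  have hs0 : 0 < s := by positivity
  have hs1 : s ≤ 1 := rpow_le_one ht0.le ht1.le (by positivity)
  have hls : log s = 2 / c * log t := log_rpow ht0 _
  set η₁ := (1 - R) * log 2 - (log (1 + s) - (d + ε) * log s) with hη₁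
  have hη₁0 : 0 < η₁ := by
    have h : c * η₁ = (1 - R) * (c * log 2) - (c * log (1 + s) - 2 * (d + ε) * log t) := by
      rw [hη₁, hls]; field_simp
    exact pos_of_mul_pos_right (by rw [h]; linarith) hc0.le
  set η₂ := log (1 + 2 * r * t + t ^ 2) - 2 * (d - ε) * log t - (1 - R) * Λ with hη₂
  have hη₂0 : 0 < η₂ := by rw [hc] at hL'; linarith
  have hZ : (1 - p) * (1 + t ^ 2) + 2 * p * t = (1 - p) * (1 + 2 * r * t + t ^ 2) := by
    rw [hr]; field_simp; ring
  have hdZ : d * ((1 - p) * (1 + t ^ 2) + 2 * p * t) = p * t + (1 - p) * t ^ 2 := by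
    rw [hZ, hd, hr]; field_simp
  filter_upwards [eventually_le_ballStability hp0 (by linarith) ht0 ht1 hε0 hεd hεd1 hdZ,
    (tendsto_natCast_atTop_atTop (R := ℝ)).eventually_ge_atTop (log 8 / η₁),
    (tendsto_natCast_atTop_atTop (R := ℝ)).eventually_gt_atTop ((Λ + log 4) / η₂)]
    with n hn h1 h2 k hk
  rw [div_le_iff₀ hη₁0] at h1
  rw [div_lt_iff₀ hη₂0] at h2
  obtain ⟨hk1, hk2⟩ := abs_lt.1 hk
  have h8 : log 8 = 3 * log 2 := by
    rw [show (8 : ℝ) = 2 ^ 3 by norm_num, log_pow]; norm_num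
  have h4 : log 4 = 2 * log 2 := by
    rw [show (4 : ℝ) = 2 ^ 2 by norm_num, log_pow]; norm_num
  refine ⟨(d + ε) * n, ?_, ?_⟩
  · calc 4 * 2 ^ k * (ballCard n ((d + ε) * n) : ℝ)
        ≤ 4 * 2 ^ k * ((1 + s) ^ n * s ^ (-((d + ε) * n))) := by
          gcongr; exact ballCard_le n hs0 hs1
      _ ≤ 2 ^ n := by
          rw [← log_le_log_iff (by positivity) (by positivity), log_mul (by positivity)
            (by positivity), log_mul (by positivity) (by positivity), log_mul (by positivity)
            (by positivity), log_pow, log_pow, log_pow, log_rpow hs0, h4]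
          have : (k : ℝ) * log 2 ≤ (R * n + 1) * log 2 := by gcongr; linarith
          rw [h8, hη₁] at h1
          linarith
  · refine lt_of_lt_of_le ?_ (mul_le_mul_of_nonneg_left hn (by positivity))
    rw [hZ, ← log_lt_log_iff (by positivity) (by positivity), log_mul (by positivity)
      (by positivity), log_mul (by positivity) (by positivity), log_mul (by positivity)
      (by positivity), log_div (by positivity) (by positivity), log_div (by positivity)
      (by positivity), log_pow, log_pow, log_pow, log_pow, log_rpow ht0, log_mul hp1.ne' hden.ne',
      one_div, log_inv]
    have : (R * n - 1) * Λ ≤ k * Λ := by gcongr; linarith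
    rw [h4, hη₂] at h2
    rw [hΛp] at this h2
    linarith

theorem errorExponent_lt_errorExponent {n : ℕ} (hn : 0 < n) {P Q : ℝ} (hP : 0 < P)
    (hPQ : P < Q) : errorExponent n Q < errorExponent n P := by
  have h1 : 0 < 1 / (n : ℝ) := by positivity
  have h2 := mul_lt_mul_of_pos_left (logb_lt_logb one_lt_two hP hPQ) h1
  simp only [errorExponent]
  linarith

end Exponent

end CodeHash

theorem mainTheorem4 (p R : ℝ) (hp0 : 0 < p) (hp : p < 1 / 2) (hR0 : 0 < R) (hR : R < 1) :
    ∃ N : ℕ, ∀ n : ℕ, N ≤ n → ∀ k : ℕ, |(k : ℝ) - R * n| < 1 →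
      ∀ S : Finset (Fin n), S.card = k →
        (∀ h : Finset (CodeHash.Vec n) → CodeHash.Vec n → CodeHash.Vec n,
          (∀ C : Finset (CodeHash.Vec n), C.card = 2 ^ k →
            CodeHash.IsMinWeightDecoder (C : Set (CodeHash.Vec n)) (h C)) →
          CodeHash.collisionProb p (CodeHash.projection S) <
              CodeHash.expectedCollisionSet k p h ∧
            CodeHash.errorExponent n (CodeHash.expectedCollisionSet k p h) <
              CodeHash.errorExponent n (CodeHash.collisionProb p (CodeHash.projection S))) ∧
        (∀ h : (Fin (2 ^ k) → CodeHash.Vec n) → CodeHash.Vec n → CodeHash.Vec n,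
          (∀ f : Fin (2 ^ k) → CodeHash.Vec n,
            CodeHash.IsMinWeightDecoder (Set.range f) (h f)) →
          CodeHash.collisionProb p (CodeHash.projection S) <
              CodeHash.expectedCollisionIndep k p h ∧
            CodeHash.errorExponent n (CodeHash.expectedCollisionIndep k p h) <
              CodeHash.errorExponent n (CodeHash.collisionProb p (CodeHash.projection S))) := by
  obtain ⟨N, hN⟩ := Filter.eventually_atTop.1
    ((CodeHash.eventually_exists_radius hp0 hp hR0 hR).and (Filter.eventually_gt_atTop 0))
  refine ⟨N, fun n hn k hk S hS => ?_⟩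
  obtain ⟨hw, hn0⟩ := hN n hn
  obtain ⟨w, hV, hlt⟩ := hw k hk
  have hkn : k ≤ n := by simpa [hS] using Finset.card_le_univ S
  have hproj : CodeHash.collisionProb p (CodeHash.projection S) = (1 - p) ^ k := by
    rw [CodeHash.collisionProb_projection, hS]
  have hpos : 0 < (1 - p) ^ k := pow_pos (by linarith) k
  rw [hproj]
  refine ⟨fun h hh => ?_, fun h hh => ?_⟩
  · have hP := hlt.trans_le (CodeHash.expect_collisionProb_ge hp0.le (by linarith) _ h
      (CodeHash.half_mul_expect_le_expect_powersetCard hkn hV hh))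
    exact ⟨hP, CodeHash.errorExponent_lt_errorExponent hn0 hpos hP⟩
  · have hP := hlt.trans_le (CodeHash.expect_collisionProb_ge hp0.le (by linarith) Finset.univ h
      (CodeHash.half_mul_expect_le_expect_pi hV hh))
    exact ⟨hP, CodeHash.errorExponent_lt_errorExponent hn0 hpos hP⟩
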